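/- Let $n\ge 0$ and $R=\mathbb C[\lambda]/(\lambda^{n+1})$. Let $F$ be the infinite wedge space: the complex vector space with basis the semi-infinite monomials $\underline{i_1}\wedge\underline{i_2}\wedge\cdots$, where $i_1>i_2>\cdots$ are integers and, for some $m\in\mathbb Z$ (the charge), $i_s=m+1-s$ for all large $s$. Let $\psi_j$ and $\psi_j^*$ $(j\in\mathbb Z)$ be the fermions on $F$: $\psi_j$ is left wedge multiplication by $\underline j$, and $\psi_j^*$ is the contraction that maps $\underline{i_1}\wedge\underline{i_2}\wedge\cdots$ to $(-1)^{s+1}$ times the monomial with $\underline{i_s}$ removed if $j=i_s$, and to $0$ if $j$ does not occur. Put $F^{(n)}=F\otimes_{\mathbb C}R=\bigoplus_{p=0}^n F\lambda^p$, an $R$-module, and write $\tau=\sum_{p=0}^n\tau_p$ with $\tau_p\in F\lambda^p$. Let $F^{(n)}_0$ be the subspace of charge $0$, $|0\rangle=(\underline 0\wedge\underline{-1}\wedge\underline{-2}\wedge\cdots)\lambda^0$ the vacuum, and, for $0\le k\le n$, $\psi_j^{(k)}=\lambda^k\psi_j$ and $\psi_j^{*(k)}=\lambda^k\psi_j^*$.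 Let $GL^{(n)}_\infty=GL_\infty(R)$ be the group of invertible matrices $g=(g_{ij})_{i,j\in\mathbb Z}$ over $R$ such that all but finitely many $g_{ij}-\delta_{ij}$ vanish. It acts $R$-linearly on $F^{(n)}$ by $g(\underline{i_1}\wedge\underline{i_2}\wedge\cdots)=g\underline{i_1}\wedge g\underline{i_2}\wedge\cdots=\sum_{j_1>j_2>\cdots}\det\bigl(g_{j_a i_b}\bigr)_{a,b\ge1}\;\underline{j_1}\wedge\underline{j_2}\wedge\cdots$, where the determinant is the common value of all large upper left blocks. Then the orbit $GL^{(n)}_\infty|0\rangle$ is exactly the set of all $\tau\in F^{(n)}_0$ with $\tau_0\neq0$ (that is, $\tau$ is nonzero modulo $\lambda$) that satisfy $$\sum_{\substack{0\le p,q\le n\\ p+q\le n}}\ \sum_{k=0}^n\sum_{l=0}^k\sum_{j\in\mathbb Z}\frac1{k+1}\,\psi_j^{(k-l)}(\tau_p)\otimes\psi_j^{*(l)}(\tau_q)=0\qquad\text{in }F^{(n)}\otimes_R F^{(n)}.$$ -/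

import Mathlib

open scoped TensorProduct

noncomputable section

namespace PolyKP

/-- A semi-infinite monomial `i 0 ∧ i 1 ∧ i 2 ∧ ⋯`: a strictly decreasing sequence of integers
with `i s = m - s` for all large `s`, for some integer `m` (its charge). -/
structure Monomial where
  seq : ℕ → ℤ
  anti : StrictAnti seq
  tail : ∃ m : ℤ, ∀ᶠ s : ℕ in Filter.atTop, seq s = m - s

namespace Monomial

/-- The monomial differs from `|m⟩ = m ∧ (m-1) ∧ (m-2) ∧ ⋯` only at finitely many places. -/
def HasCharge (v : Monomial) (m : ℤ) : Prop :=
  ∀ᶠ s : ℕ in Filter.atTop, v.seq s = m - s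

/-- The vacuum monomial `0 ∧ -1 ∧ -2 ∧ ⋯`. -/
def vac : Monomial where
  seq s := -(s : ℤ)
  anti := by intro a b h; simp only; omega
  tail := ⟨0, Filter.Eventually.of_forall fun s => by simp⟩

theorem ext_range {v w : Monomial} (h : Set.range v.seq = Set.range w.seq) : v = w := by
  have h1 : v.seq = w.seq := by
    have hv : StrictMono fun s => -v.seq s := fun a b hab => neg_lt_neg (v.anti hab)
    have hw : StrictMono fun s => -w.seq s := fun a b hab => neg_lt_neg (w.anti hab)
    have : (fun s => -v.seq s) = fun s => -w.seq s := by
      apply (StrictMono.range_inj hv hw).1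
      have e : ∀ f : ℕ → ℤ, Set.range (fun s => -f s) = Neg.neg '' Set.range f := by
        intro f; rw [← Set.range_comp]; rfl
      rw [e, e, h]
    funext s
    have := congrFun this s
    simpa using this
  cases v; cases w; cases h1; rfl

theorem eventually_le (v : Monomial) (j : ℤ) : ∀ᶠ s : ℕ in Filter.atTop, v.seq s < j := by
  obtain ⟨m, hm⟩ := v.tail
  filter_upwards [hm, Filter.eventually_gt_atTop (m - j).toNat] with s hs h
  omega

/-- The number of factors of the monomial that are larger than `j`. -/
def above (v : Monomial) (j : ℤ) : ℕ := {t : ℕ | j < v.seq t}.ncard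

/-- The monomial with the new factor `j` inserted at its place in the decreasing order. -/
def insert (v : Monomial) (j : ℤ) (hj : j ∉ Set.range v.seq) : Monomial where
  seq t := if j < v.seq t then v.seq t
    else if t = 0 ∨ j < v.seq (t - 1) then j else v.seq (t - 1)
  anti := by
    have hne : ∀ t, v.seq t ≠ j := fun t h => hj ⟨t, h⟩
    refine strictAnti_nat_of_succ_lt fun t => ?_
    have h1 := v.anti (Nat.lt_succ_self t)
    have h2 : t ≠ 0 → v.seq t < v.seq (t - 1) := fun h => v.anti (by omega)
    have h3 := hne t
    have h4 : t + 1 - 1 = t := rfl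
    simp only [h4, Nat.succ_eq_add_one, Nat.add_eq_zero_iff, one_ne_zero, and_false, false_or] at *
    by_cases h0 : t = 0
    · split_ifs <;> omega
    · have h2 := h2 h0
      split_ifs <;> omega
  tail := by
    obtain ⟨m, hm⟩ := v.tail
    refine ⟨m + 1, ?_⟩
    obtain ⟨N, hN⟩ := Filter.eventually_atTop.1 (hm.and (v.eventually_le j))
    filter_upwards [Filter.eventually_gt_atTop N] with s hs
    obtain ⟨_, h2⟩ := hN s hs.le
    obtain ⟨h3, h4⟩ := hN (s - 1) (by omega)
    rw [if_neg (by omega), if_neg (by omega), h3]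
    omega

/-- The monomial with the factor `j` (which is meant to occur in it) removed. -/
def erase (v : Monomial) (j : ℤ) : Monomial where
  seq t := if j < v.seq t then v.seq t else v.seq (t + 1)
  anti := by
    refine strictAnti_nat_of_succ_lt fun t => ?_
    have h1 := v.anti (Nat.lt_succ_self t)
    have h2 := v.anti (Nat.lt_succ_self (t + 1))
    simp only [Nat.succ_eq_add_one] at *
    split_ifs <;> omega
  tail := by
    obtain ⟨m, hm⟩ := v.tail
    refine ⟨m - 1, ?_⟩
    obtain ⟨N, hN⟩ := Filter.eventually_atTop.1 (hm.and (v.eventually_le j))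
    filter_upwards [Filter.eventually_ge_atTop N] with s hs
    obtain ⟨_, h2⟩ := hN s hs
    obtain ⟨h3, h4⟩ := hN (s + 1) (by omega)
    rw [if_neg (by omega), h3]
    push_cast
    ring

end Monomial

/-- The infinite wedge space with coefficients in `R`: the free `R`-module on the semi-infinite
monomials. -/
abbrev Fock (R : Type) [CommRing R] := Monomial →₀ R

section Fermions

variable (R : Type) [CommRing R]

open Classical in
/-- The fermion `ψ_j`: wedge multiplication by the basis vector `j`. -/
def psi (j : ℤ) : Fock R →ₗ[R] Fock R :=
  Finsupp.linearCombination R fun v : Monomial =>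
    if h : j ∈ Set.range v.seq then 0
    else Finsupp.single (v.insert j h) ((-1 : R) ^ v.above j)

open Classical in
/-- The fermion `ψ*_j`: contraction with the basis vector `j`. If `j` is the `s`-th factor (counted
from one), exactly `s - 1` factors are larger than `j`, so the sign is `(-1)^(s+1)`. -/
def psiStar (j : ℤ) : Fock R →ₗ[R] Fock R :=
  Finsupp.linearCombination R fun v : Monomial =>
    if j ∈ Set.range v.seq then Finsupp.single (v.erase j) ((-1 : R) ^ v.above j) else 0

theorem psi_eq_zero (x : Fock R) : ∃ a : ℤ, ∀ j ≤ a, psi R j x = 0 := by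
  induction x using Finsupp.induction_linear with
  | zero => exact ⟨0, fun j _ => map_zero _⟩
  | add f g hf hg =>
    obtain ⟨a, ha⟩ := hf
    obtain ⟨b, hb⟩ := hg
    refine ⟨min a b, fun j hj => ?_⟩
    rw [map_add, ha j (hj.trans (min_le_left _ _)), hb j (hj.trans (min_le_right _ _)), add_zero]
  | single v r =>
    obtain ⟨m, hm⟩ := v.tail
    obtain ⟨N, hN⟩ := Filter.eventually_atTop.1 hm
    refine ⟨m - N, fun j hj => ?_⟩
    have h : j ∈ Set.range v.seq := by
      refine ⟨(m - j).toNat, ?_⟩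
      rw [hN _ (by omega)]
      omega
    rw [psi, Finsupp.linearCombination_single, dif_pos h, smul_zero]

theorem psiStar_eq_zero (x : Fock R) : ∃ a : ℤ, ∀ j > a, psiStar R j x = 0 := by
  induction x using Finsupp.induction_linear with
  | zero => exact ⟨0, fun j _ => map_zero _⟩
  | add f g hf hg =>
    obtain ⟨a, ha⟩ := hf
    obtain ⟨b, hb⟩ := hg
    refine ⟨max a b, fun j hj => ?_⟩
    rw [map_add, ha j ((le_max_left _ _).trans_lt hj), hb j ((le_max_right _ _).trans_lt hj),
      add_zero]
  | single v r =>
    refine ⟨v.seq 0, fun j hj => ?_⟩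
    have h : j ∉ Set.range v.seq := by
      rintro ⟨t, rfl⟩
      have := v.anti.antitone (Nat.zero_le t)
      omega
    rw [psiStar, Finsupp.linearCombination_single, if_neg h, smul_zero]

/-- The span of the monomials of charge `m`. -/
def chargeSpace (m : ℤ) : Submodule R (Fock R) :=
  Finsupp.supported R R {v : Monomial | v.HasCharge m}

/-- The vacuum vector. -/
def vacuum : Fock R := Finsupp.single Monomial.vac 1

end Fermions

section Group

variable (R : Type) [CommRing R]

theorem entries_iff (g : (ℤ →₀ R) ≃ₗ[R] (ℤ →₀ R)) (s : Finset ℤ) :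
    (∀ i j : ℤ, (i ∉ s ∨ j ∉ s) →
      g (Finsupp.single j 1) i = (Finsupp.single j 1 : ℤ →₀ R) i) ↔
    (∀ j ∉ s, g (Finsupp.single j 1) = Finsupp.single j 1) ∧ ∀ i ∉ s, ∀ x, g x i = x i := by
  constructor
  · intro h
    refine ⟨fun j hj => Finsupp.ext fun i => h i j (Or.inr hj), fun i hi x => ?_⟩
    have : Finsupp.lapply i ∘ₗ g.toLinearMap = (Finsupp.lapply i : (ℤ →₀ R) →ₗ[R] R) := by
      refine Finsupp.lhom_ext' fun j => LinearMap.ext_ring ?_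
      simpa using h i j (Or.inl hi)
    exact LinearMap.congr_fun this x
  · rintro ⟨h1, h2⟩ i j (hi | hj)
    · exact h2 i hi _
    · rw [h1 j hj]

/-- The group `GL_∞(R)` of invertible matrices indexed by `ℤ` with finitely many entries different
from those of the identity, as a group of automorphisms of the free module with basis `ℤ`: there is
a finite set `s` such that every entry outside `s × s` is that of the identity. -/
def GLinf : Subgroup ((ℤ →₀ R) ≃ₗ[R] (ℤ →₀ R)) where
  carrier := {g | ∃ s : Finset ℤ, ∀ i j : ℤ, (i ∉ s ∨ j ∉ s) →
    g (Finsupp.single j 1) i = (Finsupp.single j 1 : ℤ →₀ R) i}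
  one_mem' := ⟨∅, fun _ _ _ => rfl⟩
  mul_mem' := by
    rintro g h ⟨s, hs⟩ ⟨t, ht⟩
    rw [entries_iff] at hs ht
    refine ⟨s ∪ t, (entries_iff R _ _).2 ⟨fun j hj => ?_, fun i hi x => ?_⟩⟩
    · rw [Finset.notMem_union] at hj
      rw [LinearEquiv.mul_apply, ht.1 j hj.2, hs.1 j hj.1]
    · rw [Finset.notMem_union] at hi
      rw [LinearEquiv.mul_apply, hs.2 i hi.1, ht.2 i hi.2]
  inv_mem' := by
    rintro g ⟨s, hs⟩
    rw [entries_iff] at hs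
    have key : ∀ x, g (g⁻¹ x) = x := fun x => g.apply_symm_apply x
    refine ⟨s, (entries_iff R _ _).2 ⟨fun j hj => ?_, fun i hi x => ?_⟩⟩
    · apply g.injective
      rw [key, hs.1 j hj]
    · rw [← hs.2 i hi, key]

variable {R}

/-- The upper left `N × N` block of the semi-infinite matrix with rows `w 0, w 1, …` and columns
`v 0, v 1, …` of the matrix of `g`. -/
def block (g : (ℤ →₀ R) ≃ₗ[R] (ℤ →₀ R)) (v w : Monomial) (N : ℕ) : Matrix (Fin N) (Fin N) R :=
  Matrix.of fun a b => g (Finsupp.single (v.seq b) 1) (w.seq a)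

theorem block_eq {g : (ℤ →₀ R) ≃ₗ[R] (ℤ →₀ R)} {s : Finset ℤ}
    (hs : ∀ i j : ℤ, (i ∉ s ∨ j ∉ s) →
      g (Finsupp.single j 1) i = (Finsupp.single j 1 : ℤ →₀ R) i)
    (v w : Monomial) {N : ℕ} (a b : Fin N) (h : w.seq a ∉ s ∨ v.seq b ∉ s) :
    block g v w N a b = if v.seq b = w.seq a then 1 else 0 := by
  rw [block, Matrix.of_apply, hs _ _ h, Finsupp.single_apply]

theorem block_det_row {g : (ℤ →₀ R) ≃ₗ[R] (ℤ →₀ R)} {s : Finset ℤ}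
    (hs : ∀ i j : ℤ, (i ∉ s ∨ j ∉ s) →
      g (Finsupp.single j 1) i = (Finsupp.single j 1 : ℤ →₀ R) i)
    (v w : Monomial) {N : ℕ} (a : Fin N) (h : w.seq a ∉ s)
    (h' : ∀ b : Fin N, v.seq b ≠ w.seq a) : (block g v w N).det = 0 :=
  Matrix.det_eq_zero_of_row_eq_zero a fun b => by
    rw [block_eq hs v w a b (Or.inl h), if_neg (h' b)]

theorem block_det_col {g : (ℤ →₀ R) ≃ₗ[R] (ℤ →₀ R)} {s : Finset ℤ}
    (hs : ∀ i j : ℤ, (i ∉ s ∨ j ∉ s) →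
      g (Finsupp.single j 1) i = (Finsupp.single j 1 : ℤ →₀ R) i)
    (v w : Monomial) {N : ℕ} (b : Fin N) (h : v.seq b ∉ s)
    (h' : ∀ a : Fin N, v.seq b ≠ w.seq a) : (block g v w N).det = 0 :=
  Matrix.det_eq_zero_of_column_eq_zero b fun a => by
    rw [block_eq hs v w a b (Or.inr h), if_neg (h' a)]

theorem eventually_notMem (v : Monomial) (s : Finset ℤ) :
    ∀ᶠ t : ℕ in Filter.atTop, v.seq t ∉ s := by
  obtain ⟨a, ha⟩ := s.bddBelow
  filter_upwards [v.eventually_le a] with t ht h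
  exact absurd (ha h) (not_le.2 ht)

/-- For `g` in `GL_∞(R)` the determinants of the blocks do not depend on their size, once it is
large. -/
theorem block_stable {g : (ℤ →₀ R) ≃ₗ[R] (ℤ →₀ R)} (hg : g ∈ GLinf R) (v w : Monomial) :
    ∃ c : R, ∀ᶠ N : ℕ in Filter.atTop, (block g v w N).det = c := by
  obtain ⟨s, hs⟩ := hg
  obtain ⟨m, hm⟩ := v.tail
  obtain ⟨m', hm'⟩ := w.tail
  obtain ⟨K, hK⟩ := Filter.eventually_atTop.1
    ((hm.and hm').and ((eventually_notMem v s).and (eventually_notMem w s)))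
  rcases lt_trichotomy m m' with h | h | h
  · refine ⟨0, ?_⟩
    filter_upwards [Filter.eventually_gt_atTop K] with N hN
    obtain ⟨⟨h1, h2⟩, h3, h4⟩ := hK (N - 1) (by omega)
    refine block_det_col hs v w ⟨N - 1, by omega⟩ h3 fun a => ?_
    have := w.anti.antitone (show (a : ℕ) ≤ N - 1 by omega)
    dsimp only
    omega
  · refine ⟨(block g v w K).det, ?_⟩
    filter_upwards [Filter.eventually_ge_atTop K] with N hN
    induction N, hN using Nat.le_induction with
    | base => rfl
    | succ N hN ih =>
      obtain ⟨⟨h1, h2⟩, h3, h4⟩ := hK N hN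
      rw [← ih, Matrix.det_succ_row _ (Fin.last N), Finset.sum_eq_single (Fin.last N)]
      · rw [block_eq hs v w _ _ (Or.inl (by simpa using h4)), if_pos (by simp [h1, h2, h])]
        have : (block g v w (N + 1)).submatrix (Fin.last N).succAbove (Fin.last N).succAbove =
            block g v w N := by
          ext a b
          simp [block]
        rw [this]
        simp [← two_mul]
      · intro b _ hb
        rw [block_eq hs v w _ _ (Or.inl (by simpa using h4)), if_neg]
        · simp
        · have hvw : w.seq ((Fin.last N : Fin (N + 1)) : ℕ) = v.seq N := by simp [h1, h2, h]
          rw [hvw]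
          intro e
          exact hb (Fin.ext (v.anti.injective e))
      · simp
  · refine ⟨0, ?_⟩
    filter_upwards [Filter.eventually_gt_atTop K] with N hN
    obtain ⟨⟨h1, h2⟩, h3, h4⟩ := hK (N - 1) (by omega)
    refine block_det_row hs v w ⟨N - 1, by omega⟩ h4 fun b => ?_
    have := v.anti.antitone (show (b : ℕ) ≤ N - 1 by omega)
    dsimp only
    omega

/-- The semi-infinite minor of `g` with rows `w` and columns `v`: the determinant of all large
blocks. -/
def minor (g : GLinf R) (v w : Monomial) : R := (block_stable g.2 v w).choose

theorem minor_spec (g : GLinf R) (v w : Monomial) :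
    ∀ᶠ N : ℕ in Filter.atTop, (block g.1 v w N).det = minor g v w :=
  (block_stable g.2 v w).choose_spec

theorem minor_finite (g : GLinf R) (v : Monomial) : {w | minor g v w ≠ 0}.Finite := by
  obtain ⟨s, hs⟩ := g.2
  have key : ∀ w, minor g v w ≠ 0 → Set.range w.seq \ s = Set.range v.seq \ s := by
    intro w hw
    obtain ⟨N, hN⟩ := Filter.eventually_atTop.1 (minor_spec g v w)
    apply Set.Subset.antisymm
    · rintro _ ⟨⟨a, rfl⟩, ha⟩
      refine ⟨?_, ha⟩
      by_contra h
      apply hw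
      rw [← hN (max N (a + 1)) (le_max_left _ _)]
      exact block_det_row hs v w ⟨a, by omega⟩ ha fun b hb => h ⟨b, hb⟩
    · rintro _ ⟨⟨b, rfl⟩, hb⟩
      refine ⟨?_, hb⟩
      by_contra h
      apply hw
      rw [← hN (max N (b + 1)) (le_max_left _ _)]
      exact block_det_col hs v w ⟨b, by omega⟩ hb fun a ha => h ⟨a, ha.symm⟩
  refine Set.Finite.of_finite_image (f := fun w : Monomial => Set.range w.seq ∩ s) ?_ ?_
  · refine (s.finite_toSet.finite_subsets).subset ?_
    rintro _ ⟨w, _, rfl⟩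
    exact Set.inter_subset_right
  · intro w hw w' hw' h
    apply Monomial.ext_range
    rw [← Set.inter_union_sdiff (Set.range w.seq) (s : Set ℤ),
      ← Set.inter_union_sdiff (Set.range w'.seq) (s : Set ℤ), key w hw, key w' hw']
    exact congrArg (· ∪ _) h

/-- The action of `GL_∞(R)` on the infinite wedge space: a monomial `v 0 ∧ v 1 ∧ ⋯` is sent to
`g (v 0) ∧ g (v 1) ∧ ⋯`, that is, to the sum over all monomials `w` of the minor of `g` with
columns `v` and rows `w`, times `w`. -/
def wedge (g : GLinf R) : Fock R →ₗ[R] Fock R :=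
  Finsupp.linearCombination R fun v : Monomial =>
    Finsupp.ofSupportFinite (minor g v) (minor_finite g v)

end Group

/-- The truncated polynomial ring `ℂ[λ] / (λ^(n+1))`. -/
abbrev TPoly (n : ℕ) : Type := AdjoinRoot ((Polynomial.X : Polynomial ℂ) ^ (n + 1))

/-- The class of `λ`. -/
def lam (n : ℕ) : TPoly n := AdjoinRoot.root _

/-- The coefficient of `λ^p` of a truncated polynomial. -/
def tcoeff (n p : ℕ) : TPoly n →ₗ[ℂ] ℂ :=
  Polynomial.lcoeff ℂ p ∘ₗ AdjoinRoot.modByMonicHom (Polynomial.monic_X_pow (n + 1))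

/-- The space `F^(n) = F ⊗ ℂ[λ]/(λ^(n+1))`, which is the direct sum of `n + 1` copies
`F λ^0, …, F λ^n` of the infinite wedge space `F` over `ℂ`. -/
abbrev PFock (n : ℕ) : Type := Fock (TPoly n)

/-- The component `τ_p` in the `p`-th copy of `F`, as a vector of `F`. -/
def comp (n p : ℕ) : PFock n →ₗ[ℂ] Fock ℂ := Finsupp.mapRange.linearMap (tcoeff n p)

/-- The inclusion of `F` into `F^(n)` as the `p`-th copy. -/
def incl (n p : ℕ) : Fock ℂ →ₗ[ℂ] PFock n :=
  Finsupp.mapRange.linearMap (LinearMap.toSpanSingleton ℂ (TPoly n) (lam n ^ p))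

/-- `ψ_j^(k)`: the fermion `ψ_j` on every copy of `F`, followed by the shift by `k` copies. -/
def psiP (n : ℕ) (j : ℤ) (k : ℕ) : PFock n →ₗ[TPoly n] PFock n := lam n ^ k • psi (TPoly n) j

/-- `ψ_j^{*(k)}`: the fermion `ψ*_j` on every copy of `F`, followed by the shift by `k` copies. -/
def psiStarP (n : ℕ) (j : ℤ) (k : ℕ) : PFock n →ₗ[TPoly n] PFock n :=
  lam n ^ k • psiStar (TPoly n) j

/-- The sum over `j` in the fermionic equation has only finitely many nonzero terms. -/
theorem fermionic_finite (n k l : ℕ) (x y : PFock n) :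
    (Function.support fun j : ℤ => psiP n j k x ⊗ₜ[TPoly n] psiStarP n j l y).Finite := by
  obtain ⟨a, ha⟩ := psi_eq_zero (TPoly n) x
  obtain ⟨b, hb⟩ := psiStar_eq_zero (TPoly n) y
  refine (Set.finite_Icc a b).subset fun j hj => ?_
  by_contra h
  apply hj
  simp only [Set.mem_Icc, not_and_or, not_le] at h
  rcases h with h | h
  · simp [psiP, ha j h.le]
  · simp [psiStarP, hb j h]

/-- The left side of the fermionic bilinear identity, in the tensor product of `F^(n)` with itself
over `ℂ[λ]/(λ^(n+1))`:
`∑_{p + q ≤ n} ∑_{k ≤ n} ∑_{l ≤ k} ∑_j 1/(k+1) ψ_j^(k-l) τ_p ⊗ ψ_j^{*(l)} τ_q`. -/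
def bilinearForm (n : ℕ) (τ : PFock n) : PFock n ⊗[TPoly n] PFock n :=
  ∑ p ∈ Finset.range (n + 1), ∑ q ∈ (Finset.range (n + 1)).filter fun q => p + q ≤ n,
    ∑ k ∈ Finset.range (n + 1), ∑ l ∈ Finset.range (k + 1),
      (1 / ((k : ℂ) + 1)) • ∑ᶠ j : ℤ,
        psiP n j (k - l) (incl n p (comp n p τ)) ⊗ₜ[TPoly n]
          psiStarP n j l (incl n q (comp n q τ))

/-- The orbit of the vacuum under `GL_∞(ℂ[λ]/(λ^(n+1)))`. -/
def vacuumOrbit (n : ℕ) : Set (PFock n) :=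
  Set.range fun g : GLinf (TPoly n) => wedge g (vacuum (TPoly n))

end PolyKP

end

/-! The displayed equation is the ordinary bilinear identity over R in disguise. For fixed k the k+1
values of l all give λ^k ∑_j ψ_j ⊗ ψ*_j, so the factor 1/(k+1) averages them. The pairs with p+q>n
contribute nothing because λ^(p+q)=0. Hence the left side is (1+λ+⋯+λ^n) times `omega` at (τ,τ), and
this factor is a unit (`bilinearForm_eq`). In coordinates, `omega` vanishes at (τ,τ) exactly when
the Plücker relations hold (`omega_eq_zero_iff`).

It remains to show that the orbit is the set of charge 0 solutions of the Plücker relations that are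
nonzero modulo λ. The coordinates of an orbit vector are maximal minors of a matrix, so the
relations follow from determinant expansions (`plucker_wedge_vacuum`). Invertibility of g makes some
minor nonzero modulo λ (`exists_minor_ne_zero`).

Conversely, τ_0≠0 gives a coordinate τ(w) with nonzero constant term, which is a unit since λ is
nilpotent. A solution is determined by τ(w) and the coordinates of the neighbours of w, those
monomials that differ from w in one factor (`Plucker.ext`). These data are the entries of a matrix
that is the identity on the rows of w, as in an affine chart of the Grassmannian. A group element
with these columns produces an orbit vector with the same data, hence τ itself
(`Plucker.exists_wedge_vacuum_eq`). -/

namespace PolyKP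

/-! ### Monomials: insertion, removal and charge -/

namespace Monomial

theorem above_eq {v : Monomial} {j : ℤ} {p : ℕ} (h : ∀ t, j < v.seq t ↔ t < p) :
    v.above j = p := by
  have : {t : ℕ | j < v.seq t} = Set.Iio p := Set.ext h
  rw [above, this, ← Finset.coe_Iio, Set.ncard_coe_finset, Nat.card_Iio]

theorem lt_seq_iff (v : Monomial) (j : ℤ) (t : ℕ) : j < v.seq t ↔ t < v.above j := by
  have hex : ∃ t, ¬ j < v.seq t := by
    obtain ⟨t, ht⟩ := (v.eventually_le j).exists
    exact ⟨t, ht.not_gt⟩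
  have key : ∀ t, j < v.seq t ↔ t < Nat.find hex := by
    intro t
    constructor
    · intro h
      by_contra h'
      have h1 := Nat.find_spec hex
      have h2 := v.anti.antitone (not_lt.1 h')
      omega
    · intro h
      simpa using Nat.find_min hex h
  rw [key, above_eq key]

theorem above_seq (v : Monomial) (a : ℕ) : v.above (v.seq a) = a :=
  above_eq fun _ => v.anti.lt_iff_gt

theorem erase_seq (v : Monomial) (j : ℤ) (t : ℕ) :
    (v.erase j).seq t = if t < v.above j then v.seq t else v.seq (t + 1) := by
  simp only [erase, lt_seq_iff]

theorem insert_seq (v : Monomial) (j : ℤ) (hj : j ∉ Set.range v.seq) (t : ℕ) :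
    (v.insert j hj).seq t = if t < v.above j then v.seq t else
      if t = v.above j then j else v.seq (t - 1) := by
  simp only [insert, lt_seq_iff]
  split_ifs <;> first | rfl | (exfalso; omega)

theorem mem_range_insert {v : Monomial} {j : ℤ} (hj : j ∉ Set.range v.seq) {x : ℤ} :
    x ∈ Set.range (v.insert j hj).seq ↔ x = j ∨ x ∈ Set.range v.seq := by
  constructor
  · rintro ⟨t, rfl⟩
    rw [insert_seq]
    split_ifs
    exacts [Or.inr ⟨_, rfl⟩, Or.inl rfl, Or.inr ⟨_, rfl⟩]
  · rintro (rfl | ⟨t, rfl⟩)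
    · exact ⟨v.above x, by rw [insert_seq]; simp⟩
    · by_cases h : t < v.above j
      · exact ⟨t, by rw [insert_seq, if_pos h]⟩
      · exact ⟨t + 1, by rw [insert_seq, if_neg (by omega), if_neg (by omega)]; rfl⟩

theorem mem_range_erase {v : Monomial} {j : ℤ} (hj : j ∈ Set.range v.seq) {x : ℤ} :
    x ∈ Set.range (v.erase j).seq ↔ x ≠ j ∧ x ∈ Set.range v.seq := by
  obtain ⟨a, rfl⟩ := hj
  constructor
  · rintro ⟨t, rfl⟩
    rw [erase_seq, above_seq]
    split_ifs with h
    · exact ⟨fun e => by have := v.anti.injective e; omega, _, rfl⟩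
    · exact ⟨fun e => by have := v.anti.injective e; omega, _, rfl⟩
  · rintro ⟨hx, t, rfl⟩
    have hta : t ≠ a := fun e => hx (by rw [e])
    by_cases h : t < a
    · exact ⟨t, by rw [erase_seq, above_seq, if_pos h]⟩
    · refine ⟨t - 1, ?_⟩
      rw [erase_seq, above_seq, if_neg (by omega)]
      congr 1
      omega

theorem notMem_range_erase {v : Monomial} {j : ℤ} (hj : j ∈ Set.range v.seq) :
    j ∉ Set.range (v.erase j).seq := fun h => ((mem_range_erase hj).1 h).1 rfl

theorem mem_range_insert_self {v : Monomial} {j : ℤ} (hj : j ∉ Set.range v.seq) :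
    j ∈ Set.range (v.insert j hj).seq := (mem_range_insert hj).2 (Or.inl rfl)

theorem insert_erase {v : Monomial} {j : ℤ} (hj : j ∈ Set.range v.seq) :
    (v.erase j).insert j (notMem_range_erase hj) = v := by
  apply ext_range
  ext x
  rw [mem_range_insert, mem_range_erase hj]
  by_cases h : x = j
  · simp [h, hj]
  · simp [h]

theorem erase_insert {v : Monomial} {j : ℤ} (hj : j ∉ Set.range v.seq) :
    (v.insert j hj).erase j = v := by
  apply ext_range
  ext x
  rw [mem_range_erase (mem_range_insert_self hj), mem_range_insert]
  by_cases h : x = j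
  · simp [h, hj]
  · simp [h]

theorem above_insert {v : Monomial} {j : ℤ} (hj : j ∉ Set.range v.seq) :
    (v.insert j hj).above j = v.above j := by
  refine above_eq fun t => ?_
  have h1 := v.lt_seq_iff j t
  have h2 := v.lt_seq_iff j (t - 1)
  rw [insert_seq]
  split_ifs <;> omega

theorem above_erase {v : Monomial} {j : ℤ} (hj : j ∈ Set.range v.seq) :
    (v.erase j).above j = v.above j := by
  conv_rhs => rw [← insert_erase hj]
  rw [above_insert]

theorem HasCharge.unique {v : Monomial} {m m' : ℤ} (h : v.HasCharge m) (h' : v.HasCharge m') :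
    m = m' := by
  obtain ⟨s, h1, h2⟩ := (h.and h').exists
  omega

theorem HasCharge.insert {v : Monomial} {m : ℤ} (h : v.HasCharge m) {j : ℤ}
    (hj : j ∉ Set.range v.seq) : (v.insert j hj).HasCharge (m + 1) := by
  obtain ⟨N, hN⟩ := Filter.eventually_atTop.1 h
  filter_upwards [Filter.eventually_gt_atTop (max N (v.above j))] with s hs
  rw [insert_seq, if_neg (by omega), if_neg (by omega), hN _ (by omega)]
  omega

theorem HasCharge.erase {v : Monomial} {m : ℤ} (h : v.HasCharge m) (j : ℤ) :
    (v.erase j).HasCharge (m - 1) := by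
  obtain ⟨N, hN⟩ := Filter.eventually_atTop.1 h
  filter_upwards [Filter.eventually_gt_atTop (max N (v.above j))] with s hs
  rw [erase_seq, if_neg (by omega), hN _ (by omega)]
  omega

theorem HasCharge.of_insert {v : Monomial} {m : ℤ} {j : ℤ} {hj : j ∉ Set.range v.seq}
    (h : (v.insert j hj).HasCharge m) : v.HasCharge (m - 1) := by
  simpa [erase_insert] using h.erase j

theorem HasCharge.of_erase {v : Monomial} {m : ℤ} {j : ℤ} (hj : j ∈ Set.range v.seq)
    (h : (v.erase j).HasCharge m) : v.HasCharge (m + 1) := by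
  simpa only [insert_erase hj] using h.insert (notMem_range_erase hj)

theorem eventually_seq_eq {v w : Monomial} {m : ℤ} (hv : v.HasCharge m) (hw : w.HasCharge m) :
    ∀ᶠ t : ℕ in Filter.atTop, v.seq t = w.seq t := by
  filter_upwards [hv, hw] with t h1 h2
  rw [h1, h2]

/-- Equal charge makes the two sequences agree from some N on, so the inclusion restricts to sets of
N leading factors, which have the same cardinality. -/
theorem eq_of_range_subset {v w : Monomial} {m : ℤ} (hv : v.HasCharge m) (hw : w.HasCharge m)
    (h : Set.range v.seq ⊆ Set.range w.seq) : v = w := by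
  obtain ⟨N, hN⟩ := Filter.eventually_atTop.1 (eventually_seq_eq hv hw)
  have key : (Finset.range N).image v.seq = (Finset.range N).image w.seq := by
    apply Finset.eq_of_subset_of_card_le
    · intro x hx
      obtain ⟨t, ht, rfl⟩ := Finset.mem_image.1 hx
      obtain ⟨s, hs⟩ := h ⟨t, rfl⟩
      refine Finset.mem_image.2 ⟨s, Finset.mem_range.2 ?_, hs⟩
      by_contra hsN
      have h1 := hN s (by omega)
      rw [← h1] at hs
      have := v.anti.injective hs
      have := Finset.mem_range.1 ht
      omega
    · rw [Finset.card_image_of_injective _ v.anti.injective,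
        Finset.card_image_of_injective _ w.anti.injective]
  apply ext_range
  refine h.antisymm ?_
  rintro _ ⟨t, rfl⟩
  by_cases ht : t < N
  · have : w.seq t ∈ (Finset.range N).image w.seq :=
      Finset.mem_image.2 ⟨t, Finset.mem_range.2 ht, rfl⟩
    rw [← key] at this
    obtain ⟨s, _, hs⟩ := Finset.mem_image.1 this
    exact ⟨s, hs⟩
  · exact ⟨t, hN t (by omega)⟩

theorem finite_range_diff (v w : Monomial) : (Set.range v.seq \ Set.range w.seq).Finite := by
  obtain ⟨m, hm⟩ := w.tail
  obtain ⟨N, hN⟩ := Filter.eventually_atTop.1 hm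
  refine (Set.finite_Icc (m - N) (v.seq 0)).subset ?_
  rintro _ ⟨⟨t, rfl⟩, h⟩
  refine ⟨?_, v.anti.antitone (Nat.zero_le t)⟩
  by_contra h'
  exact h ⟨(m - v.seq t).toNat, by rw [hN _ (by omega)]; omega⟩

end Monomial

/-! ### Fermions in coordinates and the Plücker relations -/

variable {R : Type} [CommRing R]

open Classical in
theorem psi_apply (j : ℤ) (x : Fock R) (u : Monomial) :
    psi R j x u = if j ∈ Set.range u.seq then (-1) ^ u.above j * x (u.erase j) else 0 := by
  induction x using Finsupp.induction_linear with
  | zero => simp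
  | add f g hf hg =>
    rw [map_add, Finsupp.add_apply, hf, hg, Finsupp.add_apply]
    split_ifs <;> ring
  | single v r =>
    rw [psi, Finsupp.linearCombination_single]
    by_cases hv : j ∈ Set.range v.seq
    · rw [dif_pos hv]
      split_ifs with hu
      · rw [Finsupp.single_eq_of_ne]
        · simp
        · rintro rfl
          exact Monomial.notMem_range_erase hu hv
      · simp
    · rw [dif_neg hv, Finsupp.smul_single, smul_eq_mul]
      by_cases h : v.insert j hv = u
      · subst h
        rw [if_pos (Monomial.mem_range_insert_self hv), Monomial.erase_insert,
          Monomial.above_insert]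
        simp [mul_comm]
      · rw [Finsupp.single_eq_of_ne (Ne.symm h)]
        split_ifs with hu
        · rw [Finsupp.single_eq_of_ne, mul_zero]
          rintro rfl
          exact h (Monomial.insert_erase hu)
        · rfl

open Classical in
theorem psiStar_apply (j : ℤ) (x : Fock R) (v : Monomial) :
    psiStar R j x v =
      if h : j ∈ Set.range v.seq then 0 else (-1) ^ v.above j * x (v.insert j h) := by
  induction x using Finsupp.induction_linear with
  | zero => simp
  | add f g hf hg =>
    rw [map_add, Finsupp.add_apply, hf, hg]
    split_ifs
    · ring
    · rw [Finsupp.add_apply]; ring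
  | single u r =>
    rw [psiStar, Finsupp.linearCombination_single]
    by_cases hu : j ∈ Set.range u.seq
    · rw [if_pos hu, Finsupp.smul_single, smul_eq_mul]
      by_cases h : u.erase j = v
      · subst h
        rw [dif_neg (Monomial.notMem_range_erase hu), Monomial.insert_erase hu,
          Monomial.above_erase hu]
        simp [mul_comm]
      · rw [Finsupp.single_eq_of_ne (Ne.symm h)]
        split_ifs with hv
        · rfl
        · rw [Finsupp.single_eq_of_ne, mul_zero]
          rintro rfl
          exact h (Monomial.erase_insert hv)
    · rw [if_neg hu]
      split_ifs with hv
      · simp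
      · rw [Finsupp.single_eq_of_ne]
        · simp
        · rintro rfl
          exact hu (Monomial.mem_range_insert_self hv)

theorem finite_support_psi_mul_psiStar (x y : Fock R) (u v : Monomial) :
    Function.HasFiniteSupport fun j : ℤ => psi R j x u * psiStar R j y v := by
  obtain ⟨a, ha⟩ := psi_eq_zero R x
  obtain ⟨b, hb⟩ := psiStar_eq_zero R y
  refine (Set.finite_Icc a b).subset fun j hj => ?_
  by_contra h
  apply hj
  simp only [Set.mem_Icc, not_and_or, not_le] at h
  rcases h with h | h
  · simp [ha j h.le]
  · simp [hb j h]

/-- The coordinates of the fermionic bilinear identity: the Plücker relations. -/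
def Plucker (x : Fock R) : Prop :=
  ∀ u v : Monomial, ∑ᶠ j : ℤ, psi R j x u * psiStar R j x v = 0

/-- A solution of the Plücker relations is determined by a unit coordinate and the coordinates
of the monomials which differ from it in one factor. -/
theorem Plucker.ext {x y : Fock R} (hx : Plucker x) (hy : Plucker y)
    (hx0 : ∀ v, x v ≠ 0 → v.HasCharge 0) (hy0 : ∀ v, y v ≠ 0 → v.HasCharge 0)
    {w : Monomial} (hw : w.HasCharge 0) (hu : IsUnit (x w))
    (h0 : x w = y w)
    (h1 : ∀ j ∈ Set.range w.seq, ∀ i (hi : i ∉ Set.range (w.erase j).seq),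
      x ((w.erase j).insert i hi) = y ((w.erase j).insert i hi)) : x = y := by
  -- Induction on the number of factors of v that do not occur in w.
  have key : ∀ d : ℕ, ∀ v : Monomial, v.HasCharge 0 →
      (Set.range v.seq \ Set.range w.seq).ncard = d → x v = y v := by
    intro d
    induction d using Nat.strong_induction_on with
    | _ d ih =>
    intro v hv hd
    rcases (Set.range v.seq \ Set.range w.seq).eq_empty_or_nonempty with he | ⟨i, hiv, hiw⟩
    · rw [Monomial.eq_of_range_subset hv hw (Set.sdiff_eq_empty.1 he), h0]
    -- If i is the only factor foreign to w, then v is a neighbour of w and `h1` applies.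
    by_cases hsub : Set.range (v.erase i).seq ⊆ Set.range w.seq
    · obtain ⟨j, hjw, hjv⟩ : ∃ j ∈ Set.range w.seq, j ∉ Set.range (v.erase i).seq := by
        by_contra! hcon
        have := Monomial.ext_range (hsub.antisymm hcon)
        have := (hv.erase i).unique (this ▸ hw)
        omega
      have h2 : (v.erase i).insert j hjv = w := by
        refine Monomial.eq_of_range_subset ((hv.erase i).insert hjv) (by simpa using hw) ?_
        intro t ht
        rcases (Monomial.mem_range_insert hjv).1 ht with rfl | ht
        exacts [hjw, hsub ht]
      have h3 : v.erase i = w.erase j := by rw [← h2, Monomial.erase_insert]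
      have h4 : i ∉ Set.range (w.erase j).seq := h3 ▸ Monomial.notMem_range_erase hiv
      have h5 : v = (w.erase j).insert i h4 := by
        conv_lhs => rw [← Monomial.insert_erase hiv]
        congr 1
      rw [h5]
      exact h1 j hjw i h4
    -- In the relation indexed by w with i added and v with i removed, the term j = i is ±x(w)x(v).
    -- Every other nonzero term is a neighbour coordinate of w times a coordinate where i is traded
    -- for some j in w, which is closer to w. Those terms agree for x and y, and the unit x(w) can
    -- be cancelled.
    · have hzero : ∑ᶠ j : ℤ, (psi R j x (w.insert i hiw) * psiStar R j x (v.erase i) -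
          psi R j y (w.insert i hiw) * psiStar R j y (v.erase i)) = 0 := by
        rw [finsum_sub_distrib (finite_support_psi_mul_psiStar _ _ _ _)
          (finite_support_psi_mul_psiStar _ _ _ _), hx, hy, sub_zero]
      rw [finsum_eq_single _ i] at hzero
      · rw [psi_apply, if_pos (Monomial.mem_range_insert_self hiw), psi_apply,
          if_pos (Monomial.mem_range_insert_self hiw), psiStar_apply,
          dif_neg (Monomial.notMem_range_erase hiv), psiStar_apply,
          dif_neg (Monomial.notMem_range_erase hiv), Monomial.erase_insert,
          Monomial.insert_erase hiv, ← h0, ← mul_sub, ← mul_sub] at hzero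
        have hpow : ∀ k : ℕ, IsUnit ((-1 : R) ^ k) := fun k => (isUnit_one.neg).pow k
        rw [((hpow _).mul hu).mul_right_eq_zero, (hpow _).mul_right_eq_zero] at hzero
        exact sub_eq_zero.1 hzero
      · intro j hji
        rw [sub_eq_zero]
        by_cases hjw : j ∈ Set.range (w.insert i hiw).seq
        swap
        · simp only [psi_apply, if_neg hjw, zero_mul]
        by_cases hjv : j ∈ Set.range (v.erase i).seq
        · simp only [psiStar_apply, dif_pos hjv, mul_zero]
        have hjw' : j ∈ Set.range w.seq := ((Monomial.mem_range_insert hiw).1 hjw).resolve_left hji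
        rw [psi_apply, if_pos hjw, psi_apply, if_pos hjw, psiStar_apply, dif_neg hjv,
          psiStar_apply, dif_neg hjv]
        have hi' : i ∉ Set.range (w.erase j).seq :=
          fun h => hiw ((Monomial.mem_range_erase hjw').1 h).2
        have e1 : (w.insert i hiw).erase j = (w.erase j).insert i hi' := by
          apply Monomial.ext_range
          ext t
          rw [Monomial.mem_range_erase hjw, Monomial.mem_range_insert, Monomial.mem_range_insert,
            Monomial.mem_range_erase hjw']
          by_cases ht : t = i
          · simp [ht, Ne.symm hji]
          · simp [ht]
        have e2 : x ((v.erase i).insert j hjv) = y ((v.erase i).insert j hjv) := by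
          refine ih _ ?_ _ (by simpa using (hv.erase i).insert hjv) rfl
          rw [← hd]
          apply Set.ncard_lt_ncard _ (Monomial.finite_range_diff _ _)
          refine Set.ssubset_iff_subset_ne.2 ⟨?_, fun e => ?_⟩
          · rintro t ⟨ht, htw⟩
            rw [Monomial.mem_range_insert, Monomial.mem_range_erase hiv] at ht
            rcases ht with rfl | ht
            · exact absurd hjw' htw
            · exact ⟨ht.2, htw⟩
          · have := e.ge ⟨hiv, hiw⟩
            have := this.1
            rw [Monomial.mem_range_insert, Monomial.mem_range_erase hiv] at this
            rcases this with rfl | h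
            · exact hji rfl
            · exact h.1 rfl
        rw [e1, e2, h1 j hjw' i hi']
  ext v
  by_cases hv : v.HasCharge 0
  · exact key _ v hv rfl
  · rw [not_imp_comm.1 (hx0 v) hv, not_imp_comm.1 (hy0 v) hv]

/-! ### Determinant expansions -/

/-- The minor of the matrix `A` with rows `i, v 0, …, v (N-1)` and columns `0, …, N`, expanded
along its first row. -/
def expansion (A : ℤ → ℕ → R) (v : Monomial) (N : ℕ) (i : ℤ) : R :=
  ∑ b : Fin (N + 1), (-1) ^ (b : ℕ) * A i b *
    (Matrix.of fun a c : Fin N => A (v.seq a) (b.succAbove c)).det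

theorem expansion_eq_zero (A : ℤ → ℕ → R) (v : Monomial) {N t : ℕ} (ht : t < N) :
    expansion A v N (v.seq t) = 0 := by
  have h := Matrix.det_succ_row_zero
    (Matrix.of fun a b : Fin (N + 1) =>
      A (Fin.cons (α := fun _ => ℤ) (v.seq t) (fun a : Fin N => v.seq a) a) b)
  rw [Matrix.det_zero_of_row_eq (i := 0) (j := Fin.succ ⟨t, ht⟩) (Fin.succ_ne_zero _).symm
    (by ext b; simp only [Matrix.of_apply, Fin.cons_zero, Fin.cons_succ])] at h
  rw [expansion, h]
  refine Finset.sum_congr rfl fun b _ => ?_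
  congr 1

/-- The new row stands at position `v.above i`; Laplace expansion along it yields the sign of moving
it to the top, which is also the sign in ψ*_i. -/
theorem det_insert (A : ℤ → ℕ → R) (v : Monomial) (i : ℤ) (hi : i ∉ Set.range v.seq) {N : ℕ}
    (hN : v.above i ≤ N) :
    (Matrix.of fun a b : Fin (N + 1) => A ((v.insert i hi).seq a) b).det =
      (-1) ^ v.above i * expansion A v N i := by
  rw [Matrix.det_succ_row _ ⟨v.above i, by omega⟩, expansion, Finset.mul_sum]
  refine Finset.sum_congr rfl fun b _ => ?_
  rw [pow_add, mul_assoc, mul_assoc, mul_assoc]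
  congr 3
  · simp [Monomial.insert_seq]
  · congr 1
    ext a c
    simp only [Matrix.submatrix_apply, Matrix.of_apply]
    congr 1
    rw [Monomial.insert_seq]
    by_cases h : (a : ℕ) < v.above i
    · rw [Fin.succAbove_of_castSucc_lt _ _ (by simpa [Fin.lt_def] using h)]
      simp [h]
    · rw [Fin.succAbove_of_le_castSucc _ _ (by simpa [Fin.le_def] using h)]
      rw [if_neg (by simp; omega), if_neg (by simp; omega)]
      simp

theorem seq_succAbove (w : Monomial) {N : ℕ} (b : Fin (N + 1)) (a : Fin N) :
    w.seq (b.succAbove a) = (w.erase (w.seq b)).seq a := by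
  rw [Monomial.erase_seq, Monomial.above_seq]
  by_cases h : (a : ℕ) < b
  · rw [Fin.succAbove_of_castSucc_lt _ _ (by simpa [Fin.lt_def] using h), if_pos h]
    rfl
  · rw [Fin.succAbove_of_le_castSucc _ _ (by simpa [Fin.le_def] using h), if_neg h]
    rfl

theorem det_updateRow_eq_expansion (A : ℤ → ℕ → R) (w : Monomial) {N : ℕ} (b : Fin (N + 1))
    (i : ℤ) :
    ((Matrix.of fun a c : Fin (N + 1) => A (w.seq a) c).updateRow b fun c => A i c).det =
      (-1) ^ (b : ℕ) * expansion A (w.erase (w.seq b)) N i := by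
  rw [Matrix.det_succ_row _ b, expansion, Finset.mul_sum]
  refine Finset.sum_congr rfl fun c _ => ?_
  rw [pow_add, mul_assoc, mul_assoc, mul_assoc]
  congr 3
  · simp
  · congr 1
    ext a c'
    simp [seq_succAbove]

/-- The finite Plücker relation. After exchanging the sums, the sum over a for fixed b expands,
along its first column, a determinant of size N+2 in which column b occurs twice. -/
theorem sum_expansion_mul_det (A : ℤ → ℕ → R) (u v : Monomial) (N : ℕ) :
    ∑ a : Fin (N + 2), (-1) ^ (a : ℕ) *
      (Matrix.of fun c b : Fin (N + 1) => A ((u.erase (u.seq a)).seq c) b).det *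
      expansion A v N (u.seq a) = 0 := by
  simp only [expansion, Finset.mul_sum]
  rw [Finset.sum_comm]
  refine Finset.sum_eq_zero fun b _ => ?_
  have h := Matrix.det_succ_column_zero
    (Matrix.of fun a c : Fin (N + 2) =>
      A (u.seq a) (Fin.cons (α := fun _ => Fin (N + 1)) b (fun c : Fin (N + 1) => c) c))
  rw [Matrix.det_zero_of_column_eq (i := 0) (j := Fin.succ b) (Fin.succ_ne_zero _).symm
    (by intro a; simp)] at h
  have h2 := congrArg (· * ((-1) ^ (b : ℕ) *
    (Matrix.of fun a c : Fin N => A (v.seq a) (b.succAbove c)).det)) h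
  simp only [zero_mul, Finset.sum_mul] at h2
  rw [h2]
  refine Finset.sum_congr rfl fun a _ => ?_
  have h3 : (Matrix.of fun a c : Fin (N + 2) =>
      A (u.seq a) (Fin.cons (α := fun _ => Fin (N + 1)) b (fun c : Fin (N + 1) => c) c)).submatrix
        a.succAbove Fin.succ =
      Matrix.of fun c b : Fin (N + 1) => A ((u.erase (u.seq a)).seq c) b := by
    ext c d
    simp [seq_succAbove]
  rw [h3]
  simp only [Matrix.of_apply, Fin.cons_zero]
  ring

/-! ### Orbit vectors satisfy the Plücker relations -/

/-- If the charges differ, the last column or the last row of every large block vanishes. -/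
theorem hasCharge_of_minor_ne_zero (g : GLinf R) {v w : Monomial} {m : ℤ} (hv : v.HasCharge m)
    (h : minor g v w ≠ 0) : w.HasCharge m := by
  obtain ⟨s, hs⟩ := g.2
  obtain ⟨m', hw⟩ := w.tail
  obtain ⟨K, hK⟩ := Filter.eventually_atTop.1
    (((hv.and hw).and ((eventually_notMem v s).and (eventually_notMem w s))))
  obtain ⟨L, hL⟩ := Filter.eventually_atTop.1 (minor_spec g v w)
  have hdet := hL (max K L + 1) (by omega)
  obtain ⟨⟨h1, h2⟩, h3, h4⟩ := hK (max K L) (by omega)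
  rcases lt_trichotomy m m' with hm | rfl | hm
  · refine absurd (hdet.symm.trans
      (block_det_col hs v w ⟨max K L, by omega⟩ h3 fun a => ?_)) h
    have := w.anti.antitone (show (a : ℕ) ≤ max K L by omega)
    dsimp only
    omega
  · exact hw
  · refine absurd (hdet.symm.trans
      (block_det_row hs v w ⟨max K L, by omega⟩ h4 fun b => ?_)) h
    have := v.anti.antitone (show (b : ℕ) ≤ max K L by omega)
    dsimp only
    omega

theorem wedge_vacuum_apply (g : GLinf R) (w : Monomial) :
    wedge g (vacuum R) w = minor g Monomial.vac w := by
  rw [wedge, vacuum, Finsupp.linearCombination_single, one_smul]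
  rfl

theorem Monomial.hasCharge_vac : Monomial.vac.HasCharge 0 :=
  Filter.Eventually.of_forall fun s => by simp [Monomial.vac]

theorem hasCharge_of_wedge_vacuum_ne_zero (g : GLinf R) {w : Monomial}
    (h : wedge g (vacuum R) w ≠ 0) : w.HasCharge 0 :=
  hasCharge_of_minor_ne_zero g Monomial.hasCharge_vac (wedge_vacuum_apply g w ▸ h)

/-- The Plücker relations hold on the orbit of the vacuum. -/
theorem plucker_wedge_vacuum (g : GLinf R) : Plucker (wedge g (vacuum R)) := by
  intro u v
  set x := wedge g (vacuum R) with hx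
  -- For other charges every term of the sum is zero.
  by_cases hcharge : u.HasCharge 1 ∧ v.HasCharge (-1)
  swap
  · rw [← finsum_zero (α := ℤ)]
    congr 1
    ext j
    by_contra hne
    apply hcharge
    have h1 := left_ne_zero_of_mul hne
    have h2 := right_ne_zero_of_mul hne
    rw [psi_apply] at h1
    rw [psiStar_apply] at h2
    split_ifs at h1 h2 with hu hv
    · exact absurd rfl h2
    · exact ⟨by simpa using (hasCharge_of_wedge_vacuum_ne_zero g
        (right_ne_zero_of_mul h1)).of_erase hu,
        by simpa using (hasCharge_of_wedge_vacuum_ne_zero g (right_ne_zero_of_mul h2)).of_insert⟩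
    all_goals exact absurd rfl h1
  obtain ⟨hu, hv⟩ := hcharge
  set A : ℤ → ℕ → R := fun i b => g.1 (Finsupp.single (Monomial.vac.seq b) 1) i with hA
  have hspec : ∀ w : Monomial, ∀ᶠ N in Filter.atTop,
      (Matrix.of fun a b : Fin (N + 1) => A (w.seq a) b).det = x w := by
    intro w
    rw [hx, wedge_vacuum_apply]
    exact (Filter.tendsto_add_atTop_nat 1).eventually (minor_spec g Monomial.vac w)
  have hfin := Monomial.finite_range_diff u v
  obtain ⟨K, hK⟩ := Filter.eventually_atTop.1 (hu.and hv)
  have hN1 := hfin.eventually_all.2 fun j _ => hspec (u.erase j)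
  have := hfin.to_subtype
  have hN2 := Filter.eventually_all.2
    fun j : ↥(Set.range u.seq \ Set.range v.seq) => hspec (v.insert j j.2.2)
  have hN3 := hfin.eventually_all.2 fun j _ => Filter.eventually_ge_atTop (v.above j)
  -- Only the finitely many j in u but not in v matter, so one block size computes all the minors
  -- involved.
  obtain ⟨N, h1, h2, h3, hNK⟩ :=
    (hN1.and (hN2.and (hN3.and (Filter.eventually_gt_atTop K)))).exists
  -- The charges differ by 2, so far out the factor t of u is the factor t-2 of v. Thus N+2 rows of
  -- u match N rows of v.
  have htail : ∀ t, N + 1 ≤ t → u.seq t ∈ Set.range v.seq := fun t ht =>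
    ⟨t - 2, by rw [(hK _ (by omega)).1, (hK _ (by omega)).2]; omega⟩
  have htail' : ∀ t, t ≤ N + 1 → u.seq t ∈ Set.range v.seq → ∃ s < N, u.seq t = v.seq s := by
    rintro t ht ⟨s, hs⟩
    refine ⟨s, ?_, hs.symm⟩
    by_contra hsN
    have e1 := v.anti.antitone (not_lt.1 hsN)
    have e2 := u.anti.antitone ht
    have e3 := (hK N (by omega)).2
    have e4 := (hK (N + 1) (by omega)).1
    push_cast at e4
    omega
  rw [finsum_eq_sum_of_support_subset (s := Finset.univ.image fun a : Fin (N + 2) => u.seq a),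
    Finset.sum_image]
  · rw [← sum_expansion_mul_det A u v N]
    refine Finset.sum_congr rfl fun a _ => ?_
    rw [psi_apply, if_pos ⟨a, rfl⟩, psiStar_apply, Monomial.above_seq]
    split_ifs with h
    · obtain ⟨s, hs, e⟩ := htail' a (by omega) h
      rw [e, expansion_eq_zero A v hs, mul_zero, mul_zero]
    · have hj : u.seq a ∈ Set.range u.seq \ Set.range v.seq := ⟨⟨a, rfl⟩, h⟩
      rw [← h1 _ hj, ← h2 ⟨_, hj⟩, det_insert A v _ _ (h3 _ hj), ← mul_assoc ((-1 : R) ^ v.above _),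
        ← pow_add, Even.neg_one_pow ⟨_, rfl⟩, one_mul]
  · intro a _ b _ hab
    exact Fin.ext (u.anti.injective hab)
  · intro j hj
    have h1 := left_ne_zero_of_mul hj
    have h2 := right_ne_zero_of_mul hj
    rw [psi_apply] at h1
    rw [psiStar_apply] at h2
    split_ifs at h1 h2 with hju hjv
    · exact absurd rfl h2
    · obtain ⟨t, rfl⟩ := hju
      have ht : t < N + 2 := by
        by_contra hcon
        exact hjv (htail t (by omega))
      simp only [Finset.coe_image, Finset.coe_univ, Set.image_univ]
      exact ⟨⟨t, ht⟩, rfl⟩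
    all_goals exact absurd rfl h1

/-! ### Orbit vectors do not vanish modulo λ -/

/-- Makes the stable block size explicit: it depends only on `s` and on where the tail of w begins,
so it can be fixed before w is chosen. -/
theorem det_block_eq_minor (g : GLinf R) {s : Finset ℤ}
    (hs : ∀ i j : ℤ, (i ∉ s ∨ j ∉ s) →
      g.1 (Finsupp.single j 1) i = (Finsupp.single j 1 : ℤ →₀ R) i)
    {N : ℕ} (hN : ∀ i ∈ s, -(N : ℤ) < i) {w : Monomial} (hw : ∀ t ≥ N, w.seq t = -(t : ℤ)) :
    (block g.1 Monomial.vac w N).det = minor g Monomial.vac w := by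
  have key : ∀ L ≥ N, (block g.1 Monomial.vac w L).det = (block g.1 Monomial.vac w N).det := by
    intro L hL
    induction L, hL using Nat.le_induction with
    | base => rfl
    | succ L hL ih =>
      have hwL := hw L hL
      have hmem : w.seq L ∉ s := fun h => by have := hN _ h; omega
      rw [← ih, Matrix.det_succ_row _ (Fin.last L), Finset.sum_eq_single (Fin.last L)]
      · rw [block_eq hs _ w _ _ (Or.inl (by simpa using hmem)), if_pos (by simp [hwL, Monomial.vac])]
        have : (block g.1 Monomial.vac w (L + 1)).submatrix (Fin.last L).succAbove
            (Fin.last L).succAbove = block g.1 Monomial.vac w L := by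
          ext a b
          simp [block]
        rw [this]
        simp [← two_mul]
      · intro b _ hb
        rw [block_eq hs _ w _ _ (Or.inl (by simpa using hmem)), if_neg]
        · simp
        · have : w.seq ((Fin.last L : Fin (L + 1)) : ℕ) = Monomial.vac.seq L := hwL
          rw [this]
          intro e
          exact hb (Fin.ext (Monomial.vac.anti.injective e))
      · simp
  obtain ⟨L, h1, h2⟩ := ((minor_spec g Monomial.vac w).and (Filter.eventually_ge_atTop N)).exists
  rw [← h1, key L h2]

theorem exists_monomial_of_finset (S : Finset ℤ) {N : ℕ} (hc : S.card = N)
    (hS : ∀ i ∈ S, -(N : ℤ) < i) :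
    ∃ v : Monomial, (∀ t < N, v.seq t ∈ S) ∧ ∀ t ≥ N, v.seq t = -(t : ℤ) := by
  let f : ℕ → ℤ := fun t =>
    if h : t < N then S.orderEmbOfFin hc ⟨N - 1 - t, by omega⟩ else -(t : ℤ)
  have h1 : ∀ t < N, f t ∈ S := fun t ht => by
    simp only [f, dif_pos ht]
    exact Finset.orderEmbOfFin_mem _ _ _
  have h2 : ∀ t ≥ N, f t = -(t : ℤ) := fun t ht => by simp only [f, dif_neg (not_lt.2 ht)]
  refine ⟨⟨f, strictAnti_nat_of_succ_lt fun t => ?_, 0, ?_⟩, h1, h2⟩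
  · by_cases ht : t + 1 < N
    · simp only [f, dif_pos ht, dif_pos (show t < N by omega)]
      rw [OrderEmbedding.lt_iff_lt, Fin.lt_def]
      simp only
      omega
    · by_cases ht' : t < N
      · have := hS _ (h1 t ht')
        rw [h2 (t + 1) (by omega)]
        push_cast
        omega
      · rw [h2 t (by omega), h2 (t + 1) (by omega)]
        push_cast
        omega
  · filter_upwards [Filter.eventually_ge_atTop N] with t ht
    rw [h2 t ht]
    ring

theorem map_apply_eq_sum (f : (ℤ →₀ R) →ₗ[R] (ℤ →₀ R)) (x : ℤ →₀ R) {T : Finset ℤ}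
    (hT : x.support ⊆ T) (k : ℤ) : f x k = ∑ i ∈ T, x i * f (Finsupp.single i 1) k := by
  have h : x = ∑ i ∈ T, x i • Finsupp.single i (1 : R) := by
    conv_lhs => rw [← Finsupp.sum_single x]
    rw [Finsupp.sum_of_support_subset x hT _ (by simp)]
    simp
  conv_lhs => rw [h]
  rw [map_sum, Finsupp.finsetSum_apply]
  simp only [map_smul, Finsupp.smul_apply, smul_eq_mul]

/-- Over a field, some coordinate of a vector in the orbit of the vacuum does not vanish. -/
theorem exists_minor_ne_zero {K : Type*} [Field K] (ε : R →+* K) (g : GLinf R) :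
    ∃ w, ε (minor g Monomial.vac w) ≠ 0 := by
  obtain ⟨s, hs⟩ := g.2
  obtain ⟨N, hN⟩ : ∃ N : ℕ, ∀ i ∈ s, -(N : ℤ) < i := by
    obtain ⟨a, ha⟩ := s.bddBelow
    exact ⟨a.natAbs + 1, fun i hi => by have : a ≤ i := ha hi; omega⟩
  let row : ℤ → Fin N → K := fun i b => ε (g.1 (Finsupp.single (Monomial.vac.seq b) 1) i)
  -- The identity g⁻¹g = 1, read in the first N columns, writes each standard vector as a
  -- combination of rows with coefficients from g⁻¹.
  have hspan : Submodule.span K (Set.range row) = ⊤ := by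
    rw [eq_top_iff, ← (Pi.basisFun K (Fin N)).span_eq, Submodule.span_le]
    rintro _ ⟨b', rfl⟩
    let T : Finset ℤ := Finset.univ.biUnion fun b : Fin N =>
      (g.1 (Finsupp.single (Monomial.vac.seq b) 1)).support
    have : Pi.basisFun K (Fin N) b' =
        ∑ i ∈ T, ε (g.1.symm (Finsupp.single i 1) (Monomial.vac.seq b')) • row i := by
      ext b
      have h := map_apply_eq_sum (g.1.symm : (ℤ →₀ R) →ₗ[R] (ℤ →₀ R))
        (g.1 (Finsupp.single (Monomial.vac.seq b) 1)) (T := T)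
        (Finset.subset_biUnion_of_mem (fun b : Fin N =>
          (g.1 (Finsupp.single (Monomial.vac.seq b) 1)).support) (Finset.mem_univ b))
        (Monomial.vac.seq b')
      have h2 := congrArg ε h
      simp only [LinearEquiv.coe_coe, LinearEquiv.symm_apply_apply, map_sum, map_mul] at h2
      rw [Finset.sum_apply, Pi.basisFun_apply]
      simp only [Pi.smul_apply, smul_eq_mul, row]
      simp only [mul_comm (ε (g.1.symm _ _))]
      rw [← h2, Finsupp.single_apply, Pi.single_apply]
      by_cases hb : b = b'
      · simp [hb]
      · rw [if_neg hb, if_neg, map_zero]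
        intro e
        exact hb (Fin.ext (Monomial.vac.anti.injective e))
    rw [this]
    exact Submodule.sum_mem _ fun i _ => Submodule.smul_mem _ _ (Submodule.subset_span ⟨i, rfl⟩)
  obtain ⟨κ, a, ha, hsp, hli⟩ := exists_linearIndependent' K row
  rw [hspan] at hsp
  have : Finite κ := hli.finite
  have : Fintype κ := Fintype.ofFinite κ
  have hcard : Fintype.card κ = N := by
    rw [← Module.finrank_eq_card_basis (Module.Basis.mk hli hsp.ge), Module.finrank_fin_fun]
  -- N of the rows form a basis. Rows with index at most -N are zero in these columns, so the chosen
  -- indices exceed -N and can be completed by the vacuum tail.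
  obtain ⟨v, hv1, hv2⟩ := exists_monomial_of_finset (Finset.univ.image a) (N := N)
    (by rw [Finset.card_image_of_injective _ ha, Finset.card_univ, hcard]) (by
      intro i hi
      obtain ⟨k, -, rfl⟩ := Finset.mem_image.1 hi
      by_contra hlt
      apply hli.ne_zero k
      ext b
      have hk : a k ∉ s := fun h => hlt (hN _ h)
      simp only [Function.comp, row, hs _ _ (Or.inl hk), Pi.zero_apply]
      rw [Finsupp.single_eq_of_ne, map_zero]
      have := b.2
      simp only [Monomial.vac]
      omega)
  refine ⟨v, ?_⟩
  rw [← det_block_eq_minor g hs hN hv2, RingHom.map_det]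
  choose f hf using fun t : Fin N => Finset.mem_image.1 (hv1 t t.2)
  have hinj : Function.Injective f := fun t t' h => by
    have : v.seq t = v.seq t' := by rw [← (hf t).2, ← (hf t').2, h]
    exact Fin.ext (v.anti.injective this)
  have hli' := hli.comp f hinj
  have hrows : ((block g.1 Monomial.vac v N).map ε).row = (row ∘ a) ∘ f := by
    ext t b
    simp [Matrix.row, block, row, (hf t).2]
  rw [← hrows, Matrix.linearIndependent_rows_iff_isUnit, Matrix.isUnit_iff_isUnit_det] at hli'
  exact hli'.ne_zero

/-! ### Solutions with a unit coordinate lie in the orbit -/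

theorem neg_one_pow_mul_self (p : ℕ) : (-1 : R) ^ p * (-1) ^ p = 1 := by
  rw [← pow_add, Even.neg_one_pow ⟨_, rfl⟩]

/-- The vacuum and w agree from some N on; the bijection between their first N factors extends to a
permutation of the finite union of both sets. -/
theorem exists_perm_of_hasCharge {w : Monomial} (hw : w.HasCharge 0) :
    ∃ π : Equiv.Perm ℤ, (∀ t : ℕ, π (-(t : ℤ)) = w.seq t) ∧
      ∃ s : Finset ℤ, ∀ j ∉ s, π j = j := by
  classical
  obtain ⟨N, hN⟩ := Filter.eventually_atTop.1 hw
  let T : Finset ℤ := (Finset.range N).image Monomial.vac.seq ∪ (Finset.range N).image w.seq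
  let f : Fin N → T := fun t => ⟨Monomial.vac.seq t, Finset.mem_union_left _
    (Finset.mem_image_of_mem _ (Finset.mem_range.2 t.2))⟩
  let f' : Fin N → T := fun t => ⟨w.seq t, Finset.mem_union_right _
    (Finset.mem_image_of_mem _ (Finset.mem_range.2 t.2))⟩
  have hf : Function.Injective f := fun a b h =>
    Fin.ext (Monomial.vac.anti.injective (congrArg Subtype.val h))
  have hf' : Function.Injective f' := fun a b h =>
    Fin.ext (w.anti.injective (congrArg Subtype.val h))
  let e : {x // x ∈ Set.range f} ≃ {x // x ∈ Set.range f'} :=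
    (Equiv.ofInjective f hf).symm.trans (Equiv.ofInjective f' hf')
  refine ⟨Equiv.Perm.ofSubtype (p := (· ∈ T)) e.extendSubtype, fun t => ?_, T, fun j hj =>
    Equiv.Perm.ofSubtype_apply_of_not_mem _ hj⟩
  by_cases ht : t < N
  · have h1 : -(t : ℤ) = (f ⟨t, ht⟩ : T) := rfl
    rw [h1, Equiv.Perm.ofSubtype_apply_coe, Equiv.extendSubtype_apply_of_mem _ _ ⟨_, rfl⟩]
    have h2 : (Equiv.ofInjective f hf).symm ⟨f ⟨t, ht⟩, ⟨_, rfl⟩⟩ = ⟨t, ht⟩ :=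
      Equiv.ofInjective_symm_apply hf _
    simp only [e, Equiv.trans_apply, h2]
    rfl
  · rw [Equiv.Perm.ofSubtype_apply_of_not_mem]
    · rw [hN t (by omega)]
      ring
    · intro h
      rcases Finset.mem_union.1 h with h | h
      · obtain ⟨a, ha, e⟩ := Finset.mem_image.1 h
        have := Finset.mem_range.1 ha
        simp only [Monomial.vac] at e
        omega
      · obtain ⟨a, ha, e⟩ := Finset.mem_image.1 h
        have := Finset.mem_range.1 ha
        have h2 := w.anti (show a < t by omega)
        have := hN t (by omega)
        omega

theorem mem_GLinf_of {g : (ℤ →₀ R) ≃ₗ[R] (ℤ →₀ R)} (s : Finset ℤ)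
    (h1 : ∀ j ∉ s, g (Finsupp.single j 1) = Finsupp.single j 1)
    (h2 : ∀ i ∉ s, ∀ j, g (Finsupp.single j 1) i = (Finsupp.single j 1 : ℤ →₀ R) i) :
    g ∈ GLinf R :=
  ⟨s, fun i j h => h.elim (fun hi => h2 i hi j) fun hj => by rw [h1 j hj]⟩

/-- A permutation of finitely many basis vectors. -/
theorem exists_GLinf_perm (π : Equiv.Perm ℤ) (s : Finset ℤ) (hπ : ∀ j ∉ s, π j = j) :
    ∃ g : GLinf R, ∀ j, g.1 (Finsupp.single j 1) = Finsupp.single (π j) 1 := by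
  refine ⟨⟨Finsupp.domLCongr π, mem_GLinf_of s (fun j hj => ?_) fun i hi j => ?_⟩, fun j => ?_⟩
  · rw [Finsupp.domLCongr_single, hπ j hj]
  · rw [Finsupp.domLCongr_single, Finsupp.single_apply, Finsupp.single_apply]
    have : π j = i ↔ j = i := by
      conv_lhs => rw [← hπ i hi]
      exact π.apply_eq_iff_eq
    simp only [this]
  · exact Finsupp.domLCongr_single _ _ _

/-- Multiplication of the basis vector `0` by a unit. -/
theorem exists_GLinf_scale (c : Rˣ) :
    ∃ g : GLinf R, ∀ j : ℤ, g.1 (Finsupp.single j 1) =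
      (if j = 0 then (c : R) else 1) • Finsupp.single j 1 := by
  let f : R → (ℤ →₀ R) →ₗ[R] (ℤ →₀ R) := fun r =>
    Finsupp.linearCombination R fun j => (if j = 0 then r else 1) • Finsupp.single j (1 : R)
  have hf : ∀ r j, f r (Finsupp.single j 1) = (if j = 0 then r else 1) • Finsupp.single j 1 :=
    fun r j => by simp only [f, Finsupp.linearCombination_single, one_smul]
  have hff : ∀ r r' : R, r * r' = 1 → f r ∘ₗ f r' = LinearMap.id := fun r r' h => by
    refine Finsupp.lhom_ext' fun j => LinearMap.ext_ring ?_
    simp only [LinearMap.comp_apply, Finsupp.lsingle_apply, hf, map_smul, LinearMap.id_apply]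
    split_ifs
    · rw [smul_smul, mul_comm, h, one_smul]
    · rw [one_smul, one_smul]
  refine ⟨⟨LinearEquiv.ofLinearMap (f c) (f ↑c⁻¹) (hff _ _ c.mul_inv) (hff _ _ c.inv_mul),
    mem_GLinf_of {0} (fun j hj => ?_) fun i hi j => ?_⟩, fun j => ?_⟩
  · rw [LinearEquiv.coe_ofLinearMap, hf, if_neg (by simpa using hj), one_smul]
  · rw [LinearEquiv.coe_ofLinearMap, hf]
    split_ifs with h0
    · subst h0
      rw [Finsupp.smul_apply, Finsupp.single_eq_of_ne (by simpa using hi), smul_zero]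
    · rw [one_smul]
  · rw [LinearEquiv.coe_ofLinearMap, hf]

/-- The unipotent transformation which adds to the basis vectors in `S` combinations of the basis
vectors outside `S`. -/
theorem exists_GLinf_unipotent (S : Set ℤ) (y : ℤ → ℤ →₀ R)
    (hy : ∀ j ∈ S, ∀ i ∈ S, y j i = (Finsupp.single j 1 : ℤ →₀ R) i) (s : Finset ℤ)
    (hs : ∀ j ∈ S, j ∉ s → y j = Finsupp.single j 1) :
    ∃ g : GLinf R, ∀ j ∈ S, g.1 (Finsupp.single j 1) = y j := by
  classical
  let x : ℤ → ℤ →₀ R := fun j => if j ∈ S then y j - Finsupp.single j 1 else 0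
  let X : (ℤ →₀ R) →ₗ[R] (ℤ →₀ R) := Finsupp.linearCombination R x
  have hX : ∀ j, X (Finsupp.single j 1) = x j := fun j => by
    simp only [X, Finsupp.linearCombination_single, one_smul]
  have hx0 : ∀ j, ∀ i ∈ S, x j i = 0 := fun j i hi => by
    simp only [x]
    split_ifs with hj
    · rw [Finsupp.sub_apply, hy j hj i hi, sub_self]
    · rfl
  have hXx : ∀ j, X (x j) = 0 := fun j => by
    rw [Finsupp.linearCombination_apply]
    refine Finset.sum_eq_zero fun i _ => ?_
    by_cases hi : i ∈ S
    · simp only [hx0 j i hi, zero_smul]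
    · simp only [x, if_neg hi, smul_zero]
  -- The image of X involves only basis vectors outside S, where X vanishes. So 1+X has inverse 1-X.
  have hXX : X ∘ₗ X = 0 := Finsupp.lhom_ext' fun j => LinearMap.ext_ring (by simp [hX, hXx])
  have hxs : ∀ j ∉ s, x j = 0 := fun j hj => by
    simp only [x]
    split_ifs with h
    · rw [hs j h hj, sub_self]
    · rfl
  let g : (ℤ →₀ R) ≃ₗ[R] (ℤ →₀ R) := LinearEquiv.ofLinearMap (LinearMap.id + X) (LinearMap.id - X)
    (by rw [LinearMap.add_comp, LinearMap.comp_sub, LinearMap.comp_sub, hXX]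
        simp only [LinearMap.comp_id, LinearMap.id_comp]; abel)
    (by rw [LinearMap.sub_comp, LinearMap.comp_add, LinearMap.comp_add, hXX]
        simp only [LinearMap.comp_id, LinearMap.id_comp]; abel)
  have hg : ∀ j, g (Finsupp.single j 1) = Finsupp.single j 1 + x j := fun j => by
    simp [g, hX]
  refine ⟨⟨g, mem_GLinf_of (s ∪ s.biUnion fun j => (x j).support) (fun j hj => ?_)
    fun i hi j => ?_⟩, fun j hj => ?_⟩
  · rw [hg, hxs j fun h => hj (Finset.mem_union_left _ h), add_zero]
  · rw [hg, Finsupp.add_apply, add_eq_left]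
    by_cases hj : j ∈ s
    · by_contra h
      exact hi (Finset.mem_union_right _
        (Finset.mem_biUnion.2 ⟨j, hj, Finsupp.mem_support_iff.2 h⟩))
    · rw [hxs j hj]
      rfl
  · simp only [hg, x, if_pos hj]
    abel

theorem finite_support_psiStar (x : Fock R) (v : Monomial) :
    (Function.support fun i : ℤ => psiStar R i x v).Finite := by
  obtain ⟨b, hb⟩ := psiStar_eq_zero R x
  obtain ⟨m, hm⟩ := v.tail
  obtain ⟨N, hN⟩ := Filter.eventually_atTop.1 hm
  refine (Set.finite_Icc (m - N) b).subset fun i hi => ?_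
  by_contra h
  apply hi
  simp only [Set.mem_Icc, not_and_or, not_le] at h
  rcases h with h | h
  · have : i ∈ Set.range v.seq := ⟨(m - i).toNat, by rw [hN _ (by omega)]; omega⟩
    exact (psiStar_apply _ _ _).trans (dif_pos this)
  · simp [hb i h]

/-- The vector that replaces the factor `j` of the monomial `w` in the decomposable vector with
the coordinates of `x` at `w` and the monomials next to it. -/
noncomputable def column (x : Fock R) (w : Monomial) (r : R) (j : ℤ) : ℤ →₀ R :=
  Finsupp.ofSupportFinite (fun i => r * (-1) ^ w.above j * psiStar R i x (w.erase j))
    ((finite_support_psiStar x (w.erase j)).subset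
      (Function.support_subset_iff'.2 fun i hi => by
        rw [Function.notMem_support.1 hi, mul_zero]))

theorem column_apply (x : Fock R) (w : Monomial) (r : R) (j i : ℤ) :
    column x w r j i = r * (-1) ^ w.above j * psiStar R i x (w.erase j) := rfl

/-- The normalisation by r = x(w)⁻¹ makes the columns the identity matrix on the rows of w. -/
theorem column_apply_of_mem {x : Fock R} {w : Monomial} {r : R} (hr : r * x w = 1) {i j : ℤ}
    (hj : j ∈ Set.range w.seq) (hi : i ∈ Set.range w.seq) :
    column x w r j i = (Finsupp.single j 1 : ℤ →₀ R) i := by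
  rw [column_apply, psiStar_apply]
  by_cases hij : i = j
  · subst hij
    rw [dif_neg (Monomial.notMem_range_erase hj), Finsupp.single_eq_same, Monomial.insert_erase hj,
      Monomial.above_erase hj]
    linear_combination hr * ((-1) ^ w.above i * (-1) ^ w.above i) +
      neg_one_pow_mul_self (R := R) (w.above i)
  · rw [dif_pos ((Monomial.mem_range_erase hj).2 ⟨hij, hi⟩), mul_zero, Finsupp.single_eq_of_ne hij]

/-- For large t each of the finitely many monomials in the support of x contains the factor `w.seq
t`, so no neighbour of w lacking it contributes. This gives the finiteness required in `GLinf`. -/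
theorem exists_column_eq_single {x : Fock R} (hx0 : ∀ v, x v ≠ 0 → v.HasCharge 0) {w : Monomial}
    (hw : w.HasCharge 0) {r : R} (hr : r * x w = 1) :
    ∃ s : Finset ℤ, ∀ j ∈ Set.range w.seq, j ∉ s → column x w r j = Finsupp.single j 1 := by
  classical
  have h : ∀ᶠ t : ℕ in Filter.atTop, ∀ v ∈ x.support, v.seq t = w.seq t :=
    (Filter.eventually_all_finset _).2 fun v hv =>
      Monomial.eventually_seq_eq (hx0 v (Finsupp.mem_support_iff.1 hv)) hw
  obtain ⟨N, hN⟩ := Filter.eventually_atTop.1 h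
  refine ⟨(Finset.range N).image w.seq, ?_⟩
  rintro _ ⟨t, rfl⟩ ht
  have htN : N ≤ t := by
    by_contra hlt
    exact ht (Finset.mem_image_of_mem _ (Finset.mem_range.2 (not_le.1 hlt)))
  ext i
  by_cases hi : i ∈ Set.range w.seq
  · exact column_apply_of_mem hr ⟨t, rfl⟩ hi
  · have hit : i ≠ w.seq t := fun e => hi ⟨t, e.symm⟩
    rw [Finsupp.single_eq_of_ne hit, column_apply, psiStar_apply]
    split_ifs with h'
    · rw [mul_zero]
    · by_cases hz : x ((w.erase (w.seq t)).insert i h') = 0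
      · rw [hz, mul_zero, mul_zero]
      · exfalso
        have h3 := hN t htN _ (Finsupp.mem_support_iff.2 hz)
        have h4 : w.seq t ∈ Set.range ((w.erase (w.seq t)).insert i h').seq := ⟨t, h3⟩
        rcases (Monomial.mem_range_insert h').1 h4 with e | e
        · exact hit e.symm
        · exact Monomial.notMem_range_erase ⟨t, rfl⟩ e

/-- A solution of the Plücker relations with a unit coordinate is in the orbit of the vacuum. -/
theorem Plucker.exists_wedge_vacuum_eq {x : Fock R} (hx : Plucker x)
    (hx0 : ∀ v, x v ≠ 0 → v.HasCharge 0) {w : Monomial} (hw : w.HasCharge 0)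
    (hu : IsUnit (x w)) : ∃ g : GLinf R, wedge g (vacuum R) = x := by
  obtain ⟨c, hc⟩ := hu
  have hr : ((c⁻¹ : Rˣ) : R) * x w = 1 := by rw [← hc, c.inv_mul]
  set r : R := ((c⁻¹ : Rˣ) : R)
  obtain ⟨π, hπ, s, hs⟩ := exists_perm_of_hasCharge hw
  obtain ⟨P, hP⟩ := exists_GLinf_perm (R := R) π s hs
  obtain ⟨D, hD⟩ := exists_GLinf_scale c
  obtain ⟨s', hs'⟩ := exists_column_eq_single hx0 hw hr
  obtain ⟨U, hU⟩ := exists_GLinf_unipotent (Set.range w.seq) (column x w r)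
    (fun j hj i hi => column_apply_of_mem hr hj hi) s' hs'
  -- D supplies the overall factor x(w), P carries the vacuum to w, and U replaces each factor of w
  -- by its column.
  let g : GLinf R := U * P * D
  let A : ℤ → ℕ → R := fun i b => column x w r (w.seq b) i
  have hg : ∀ b : ℕ, g.1 (Finsupp.single (Monomial.vac.seq b) 1) =
      (if b = 0 then x w else 1) • column x w r (w.seq b) := by
    intro b
    have h1 : g.1 (Finsupp.single (Monomial.vac.seq b) 1) =
      U.1 (P.1 (D.1 (Finsupp.single (Monomial.vac.seq b) 1))) := rfl
    rw [h1, hD, map_smul, map_smul, hP, ← hU _ ⟨b, rfl⟩, ← hπ, hc]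
    simp [Monomial.vac]
  have hminor : ∀ v, ∀ᶠ N in Filter.atTop, wedge g (vacuum R) v =
      x w * (Matrix.of fun a b : Fin (N + 1) => A (v.seq a) b).det := by
    intro v
    filter_upwards [(Filter.tendsto_add_atTop_nat 1).eventually (minor_spec g Monomial.vac v)]
      with N hN
    rw [wedge_vacuum_apply, ← hN]
    have hprod : ∏ b : Fin (N + 1), (if (b : ℕ) = 0 then x w else 1) = x w := by
      rw [Fin.prod_univ_succ]
      simp
    conv_rhs => rw [← hprod, ← Matrix.det_mul_row]
    congr 1
    ext a b
    rw [block, Matrix.of_apply, hg]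
    rfl
  have hone : ∀ N, (Matrix.of fun a b : Fin (N + 1) => A (w.seq a) b) = 1 := by
    intro N
    ext a b
    rw [Matrix.of_apply, Matrix.one_apply]
    simp only [A]
    rw [column_apply_of_mem hr ⟨b, rfl⟩ ⟨a, rfl⟩, Finsupp.single_apply]
    refine if_congr ⟨fun e => Fin.ext (w.anti.injective e).symm, fun e => by rw [e]⟩ rfl rfl
  refine ⟨g, (hx.ext (plucker_wedge_vacuum g) hx0
    (fun v => hasCharge_of_wedge_vacuum_ne_zero g) hw (hc ▸ c.isUnit) ?_ ?_).symm⟩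
  · obtain ⟨N, hN⟩ := (hminor w).exists
    rw [hN, hone, Matrix.det_one, mul_one]
  · rintro _ ⟨b, rfl⟩ i hi
    obtain ⟨N, hN, h1, h2⟩ := ((hminor ((w.erase (w.seq b)).insert i hi)).and
      ((Filter.eventually_ge_atTop b).and
        (Filter.eventually_ge_atTop ((w.erase (w.seq b)).above i)))).exists
    rw [hN, det_insert A _ _ hi h2]
    have h3 := det_updateRow_eq_expansion A w (N := N) ⟨b, by omega⟩ i
    -- Replacing row b of the identity by row i of A gives determinant `A i b`, so a neighbour's
    -- minor is a single column entry up to sign.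
    rw [hone, ← Matrix.cramer_transpose_apply, Matrix.transpose_one, Matrix.cramer_one] at h3
    have h4 : A i b = r * (-1) ^ b * ((-1) ^ (w.erase (w.seq b)).above i *
        x ((w.erase (w.seq b)).insert i hi)) := by
      simp only [A, column_apply, Monomial.above_seq, psiStar_apply, dif_neg hi]
    have h5 : A i b = (-1) ^ b * expansion A (w.erase (w.seq b)) N i := h3
    rw [h4] at h5
    have e1 := neg_one_pow_mul_self (R := R) b
    set p := (w.erase (w.seq b)).above i
    set q := x ((w.erase (w.seq b)).insert i hi)
    set E := expansion A (w.erase (w.seq b)) N i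
    have e2 := neg_one_pow_mul_self (R := R) p
    have e3 : E = r * ((-1) ^ p * q) := by
      linear_combination (-(-1) ^ b) * h5 + (r * (-1) ^ p * q - E) * e1
    rw [e3]
    linear_combination (-q) * hr * ((-1 : R) ^ p * (-1) ^ p) - q * e2

/-! ### The bilinear identity over an arbitrary ring -/

section Omega

variable (R : Type) [CommRing R]

theorem finite_support_omega (x y : Fock R) :
    Function.HasFiniteSupport fun j : ℤ => psi R j x ⊗ₜ[R] psiStar R j y := by
  obtain ⟨a, ha⟩ := psi_eq_zero R x
  obtain ⟨b, hb⟩ := psiStar_eq_zero R y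
  refine (Set.finite_Icc a b).subset fun j hj => ?_
  by_contra h
  apply hj
  simp only [Set.mem_Icc, not_and_or, not_le] at h
  rcases h with h | h
  · simp [ha j h.le]
  · simp [hb j h]

/-- The bilinear map `(x, y) ↦ ∑_j ψ_j x ⊗ ψ*_j y`. -/
noncomputable def omega : Fock R →ₗ[R] Fock R →ₗ[R] Fock R ⊗[R] Fock R :=
  LinearMap.mk₂ R (fun x y => ∑ᶠ j : ℤ, psi R j x ⊗ₜ[R] psiStar R j y)
    (fun x x' y => by
      rw [← finsum_add_distrib (finite_support_omega R x y) (finite_support_omega R x' y)]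
      simp only [map_add, TensorProduct.add_tmul])
    (fun c x y => by
      rw [smul_finsum' c (finite_support_omega R x y)]
      simp only [map_smul, TensorProduct.smul_tmul'])
    (fun x y y' => by
      rw [← finsum_add_distrib (finite_support_omega R x y) (finite_support_omega R x y')]
      simp only [map_add, TensorProduct.tmul_add])
    (fun c x y => by
      rw [smul_finsum' c (finite_support_omega R x y)]
      simp only [map_smul, TensorProduct.tmul_smul])

theorem omega_apply (x y : Fock R) :
    omega R x y = ∑ᶠ j : ℤ, psi R j x ⊗ₜ[R] psiStar R j y := rfl

/-- The tensor square is free on pairs of monomials, and the relations are the coordinates of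
`omega` in that basis. -/
theorem omega_eq_zero_iff (x : Fock R) : omega R x x = 0 ↔ Plucker x := by
  have h : ∀ u v, finsuppTensorFinsupp' R Monomial Monomial (omega R x x) (u, v) =
      ∑ᶠ j : ℤ, psi R j x u * psiStar R j x v := fun u v => by
    let f : Fock R ⊗[R] Fock R →ₗ[R] R := Finsupp.lapply (R := R) (M := R) (u, v) ∘ₗ
      (finsuppTensorFinsupp' R Monomial Monomial).toLinearMap
    have := map_finsum f (finite_support_omega R x x)
    refine this.trans (finsum_congr fun j => ?_)
    exact finsuppTensorFinsupp'_apply_apply R Monomial Monomial (psi R j x) (psiStar R j x) u v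
  rw [← LinearEquiv.map_eq_zero_iff (finsuppTensorFinsupp' R Monomial Monomial), Finsupp.ext_iff]
  simp only [Prod.forall, h, Finsupp.coe_zero, Pi.zero_apply, Plucker]

end Omega

/-! ### Truncated polynomials and the reduction to `omega` -/

variable (n : ℕ)

theorem lam_pow_eq_zero {p : ℕ} (hp : n < p) : lam n ^ p = 0 := by
  have h : lam n ^ (n + 1) = 0 := by
    have := AdjoinRoot.eval₂_root ((Polynomial.X : Polynomial ℂ) ^ (n + 1))
    simpa [lam] using this
  rw [show p = n + 1 + (p - (n + 1)) by omega, pow_add, h, zero_mul]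

theorem tcoeff_mk (p : ℕ) (hp : p ≤ n) (f : Polynomial ℂ) :
    tcoeff n p (AdjoinRoot.mk _ f) = f.coeff p := by
  have h : tcoeff n p (AdjoinRoot.mk _ f) = (f %ₘ Polynomial.X ^ (n + 1)).coeff p := by
    simp [tcoeff]
  rw [h]
  conv_rhs => rw [← Polynomial.modByMonic_add_div f (Polynomial.X ^ (n + 1))]
  rw [Polynomial.coeff_add, Polynomial.coeff_X_pow_mul', if_neg (by omega), add_zero]

theorem sum_tcoeff_smul (r : TPoly n) :
    ∑ p ∈ Finset.range (n + 1), tcoeff n p r • lam n ^ p = r := by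
  obtain ⟨f, rfl⟩ := AdjoinRoot.mk_surjective r
  have h : AdjoinRoot.mk (Polynomial.X ^ (n + 1)) f =
      ∑ p ∈ Finset.range (n + 1 + f.natDegree), f.coeff p • lam n ^ p := by
    conv_lhs => rw [f.as_sum_range_C_mul_X_pow' (n := n + 1 + f.natDegree) (by omega)]
    rw [map_sum]
    refine Finset.sum_congr rfl fun p _ => ?_
    rw [map_mul, map_pow, AdjoinRoot.mk_X, Algebra.smul_def]
    rfl
  conv_rhs => rw [h]
  rw [Finset.sum_range_add _ (n + 1), Finset.sum_eq_zero (s := Finset.range f.natDegree), add_zero]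
  · refine Finset.sum_congr rfl fun p hp => ?_
    rw [tcoeff_mk n p (by have := Finset.mem_range.1 hp; omega)]
  · intro p _
    rw [lam_pow_eq_zero n (by omega), smul_zero]

/-- A nonzero constant plus a nilpotent element is a unit. -/
theorem isUnit_of_tcoeff_ne_zero {r : TPoly n} (h : tcoeff n 0 r ≠ 0) : IsUnit r := by
  rw [← sum_tcoeff_smul n r, Finset.sum_range_succ']
  have h1 : IsUnit (tcoeff n 0 r • lam n ^ 0) := by
    rw [pow_zero, Algebra.smul_def, mul_one]
    exact (IsUnit.mk0 _ h).map _
  refine IsNilpotent.isUnit_add_right_of_commute ?_ h1 (Commute.all _ _)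
  refine isNilpotent_sum fun p _ => ?_
  refine ⟨n + 1, ?_⟩
  rw [smul_pow, ← pow_mul, lam_pow_eq_zero n (by nlinarith), smul_zero]

/-- Reduction modulo `λ`. -/
noncomputable def reduction : TPoly n →+* ℂ :=
  AdjoinRoot.lift (RingHom.id ℂ) 0 (by simp)

theorem tcoeff_zero_eq (r : TPoly n) : tcoeff n 0 r = reduction n r := by
  obtain ⟨f, rfl⟩ := AdjoinRoot.mk_surjective r
  rw [tcoeff_mk n 0 (Nat.zero_le n), reduction, AdjoinRoot.lift_mk, Polynomial.coeff_zero_eq_eval_zero]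
  rfl

theorem incl_apply (p : ℕ) (y : Fock ℂ) (v : Monomial) : incl n p y v = y v • lam n ^ p := by
  simp [incl]

theorem sum_incl_comp (x : PFock n) :
    ∑ p ∈ Finset.range (n + 1), incl n p (comp n p x) = x := by
  ext v
  rw [Finsupp.finsetSum_apply]
  conv_rhs => rw [← sum_tcoeff_smul n (x v)]
  refine Finset.sum_congr rfl fun p _ => ?_
  rw [incl_apply]
  rfl

theorem incl_eq_smul (p : ℕ) (y : Fock ℂ) : incl n p y = lam n ^ p • incl n 0 y := by
  ext v
  rw [Finsupp.smul_apply, incl_apply, incl_apply, pow_zero, smul_eq_mul, mul_smul_comm, mul_one]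

theorem sum_psiP_tmul (k : ℕ) (x y : PFock n) :
    ∑ l ∈ Finset.range (k + 1), (1 / ((k : ℂ) + 1)) • ∑ᶠ j : ℤ,
      psiP n j (k - l) x ⊗ₜ[TPoly n] psiStarP n j l y = lam n ^ k • omega (TPoly n) x y := by
  have h : ∀ l ∈ Finset.range (k + 1), (1 / ((k : ℂ) + 1)) • ∑ᶠ j : ℤ,
      psiP n j (k - l) x ⊗ₜ[TPoly n] psiStarP n j l y =
        (1 / ((k : ℂ) + 1)) • lam n ^ k • omega (TPoly n) x y := by
    intro l hl
    have := Finset.mem_range.1 hl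
    rw [omega_apply, smul_finsum' _ (finite_support_omega _ x y)]
    congr 1
    refine finsum_congr fun j => ?_
    rw [psiP, psiStarP, LinearMap.smul_apply, LinearMap.smul_apply, TensorProduct.smul_tmul_smul,
      ← pow_add]
    congr 2
    omega
  rw [Finset.sum_congr rfl h, Finset.sum_const, Finset.card_range, ← Nat.cast_smul_eq_nsmul ℂ,
    smul_smul]
  have hk : (k : ℂ) + 1 ≠ 0 := Nat.cast_add_one_ne_zero k
  rw [show ((k + 1 : ℕ) : ℂ) * (1 / ((k : ℂ) + 1)) = 1 by push_cast; field_simp, one_smul]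

theorem bilinearForm_eq (x : PFock n) :
    bilinearForm n x = (∑ k ∈ Finset.range (n + 1), lam n ^ k) • omega (TPoly n) x x := by
  have h : omega (TPoly n) x x = ∑ p ∈ Finset.range (n + 1), ∑ q ∈ Finset.range (n + 1),
      omega (TPoly n) (incl n p (comp n p x)) (incl n q (comp n q x)) := by
    conv_lhs => rw [← sum_incl_comp n x]
    simp only [map_sum, LinearMap.sum_apply]
    exact Finset.sum_comm
  rw [h, bilinearForm]
  simp only [sum_psiP_tmul, Finset.smul_sum]
  refine Finset.sum_congr rfl fun p _ => ?_
  rw [Finset.sum_filter]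
  refine Finset.sum_congr rfl fun q _ => ?_
  split_ifs with hpq
  · rw [Finset.sum_smul]
  · have hz : omega (TPoly n) (incl n p (comp n p x)) (incl n q (comp n q x)) = 0 := by
      rw [incl_eq_smul n p, incl_eq_smul n q, map_smul, map_smul, LinearMap.smul_apply, smul_smul,
        ← pow_add, lam_pow_eq_zero n (by omega), zero_smul]
    rw [hz, smul_zero]

theorem bilinearForm_eq_zero_iff (x : PFock n) : bilinearForm n x = 0 ↔ Plucker x := by
  have h : IsUnit (∑ k ∈ Finset.range (n + 1), lam n ^ k) := by
    -- Geometric series: the product with 1-λ is 1-λ^(n+1) = 1.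
    refine IsUnit.of_mul_eq_one (1 - lam n) ?_
    rw [geom_sum_mul_neg, lam_pow_eq_zero n (by omega), sub_zero]
  rw [bilinearForm_eq, h.smul_eq_zero, omega_eq_zero_iff]

end PolyKP

/-! ### The orbit theorem -/

theorem mainTheorem6 (n : ℕ) :
    PolyKP.vacuumOrbit n =
      {τ : PolyKP.PFock n | τ ∈ PolyKP.chargeSpace (PolyKP.TPoly n) 0 ∧
        PolyKP.comp n 0 τ ≠ 0 ∧ PolyKP.bilinearForm n τ = 0} := by
  have hcharge : ∀ τ : PolyKP.PFock n, τ ∈ PolyKP.chargeSpace (PolyKP.TPoly n) 0 ↔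
      ∀ v, τ v ≠ 0 → v.HasCharge 0 := fun τ => by
    rw [PolyKP.chargeSpace, Finsupp.mem_supported]
    exact forall_congr' fun v => by rw [Finset.mem_coe, Finsupp.mem_support_iff]; rfl
  ext τ
  rw [Set.mem_ofPred_eq, PolyKP.bilinearForm_eq_zero_iff, hcharge]
  constructor
  · rintro ⟨g, rfl⟩
    refine ⟨fun v => PolyKP.hasCharge_of_wedge_vacuum_ne_zero g, fun h => ?_,
      PolyKP.plucker_wedge_vacuum g⟩
    obtain ⟨w, hw⟩ := PolyKP.exists_minor_ne_zero (PolyKP.reduction n) g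
    apply hw
    rw [← PolyKP.wedge_vacuum_apply, ← PolyKP.tcoeff_zero_eq]
    exact DFunLike.congr_fun h w
  · rintro ⟨h0, h1, h2⟩
    obtain ⟨w, hw⟩ := Finsupp.ne_iff.1 h1
    have hw' : PolyKP.tcoeff n 0 (τ w) ≠ 0 := hw
    exact h2.exists_wedge_vacuum_eq h0
      (h0 w fun e => hw' (by rw [e, map_zero])) (PolyKP.isUnit_of_tcoeff_ne_zero n hw')
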